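/- **Theorem 1.** A discrete-time MDP $(\mathcal S,\mathcal A,P,R,\gamma,\mu)$ with discount $\gamma\in[0,1]$, together with a horizon $H$ and a policy $\pi_\theta$, induces a distribution $p_\theta$ over trajectories $\tau=(s_0,a_0,\dots,s_{H-1},a_{H-1})$. The return of $\tau$ is $R(\tau)=\sum_{h<H}\gamma^hR(s_h,a_h)$, and $J(\theta)=\mathbb E_{\tau\sim p_\theta}[R(\tau)]$. At each round $t$ an algorithm (possibly randomized) selects a parameter $\theta_t\in\Theta$ based on the past triples $(\theta_i,\tau_i,R(\tau_i))_{i<t}$ and then observes $\tau_t\sim p_{\theta_t}$ and $R(\tau_t)$ (mediator feedback). Its expected regret is $\mathbb E R(n)=\mathbb E\sum_{t=1}^n\big(\max_{\theta\in\Theta} J(\theta)-J(\theta_t)\big)$. For every $\Delta>0$ there exist two MDPs $\nu_1,\nu_2$, which differ only in their transition model, a horizon $H$, and two policies $\pi_{\theta_1},\pi_{\theta_2}$ (so $\Theta=\{\theta_1,\theta_2\}$) such that, for each $\nu\in\{\nu_1,\nu_2\}$, $$\mathrm{KL}(p^{\nu}_{\theta_1}\|p^{\nu}_{\theta_2})<\infty,\qquad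 \mathrm{KL}(p^{\nu}_{\theta_2}\|p^{\nu}_{\theta_1})<\infty,$$ the returns are integrable under $p^\nu_{\theta_1}$ and $p^\nu_{\theta_2}$, and, if $\Delta<1$, almost surely in $[0,1]$. Moreover the gap is $\Delta$ in both problems, with the roles of the two policies exchanged: $$J^{\nu_1}(\theta_1)-J^{\nu_1}(\theta_2)=\Delta=J^{\nu_2}(\theta_2)-J^{\nu_2}(\theta_1).$$ Furthermore, there is $N$ such that for all $n\ge N$ every algorithm satisfies $$\max\big\{\mathbb E_{\nu_1}R(n),\ \mathbb E_{\nu_2}R(n)\big\}\ \ge\ \frac1{32\,\Delta}.$$ That is, no algorithm can guarantee regret below the constant $1/(32\Delta)$ on both problems. -/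

import Mathlib

open MeasureTheory ProbabilityTheory

open scoped ENNReal

namespace PolicyOpt

/-- A discrete-time Markov decision process on measurable state and action spaces. -/
structure MDP (S A : Type*) [MeasurableSpace S] [MeasurableSpace A] where
  /-- distribution of the initial state -/
  init : Measure S
  /-- transition model: the law of the next state given the current state and action -/
  trans : Kernel (S × A) S
  /-- reward function -/
  reward : S × A → ℝ
  /-- discount factor -/
  discount : ℝ
  init_prob : IsProbabilityMeasure init
  trans_markov : IsMarkovKernel trans
  measurable_reward : Measurable reward
  discount_mem : discount ∈ Set.Icc (0 : ℝ) 1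

attribute [instance] MDP.init_prob MDP.trans_markov

/-- Trajectories `(s₀, a₀, …, s_{H-1}, a_{H-1})` of length `H`. -/
abbrev Trajectory (S A : Type*) (H : ℕ) : Type _ := Fin H → S × A

/-- What is observed at the end of a round: the trajectory and its return. -/
abbrev Feedback (S A : Type*) (H : ℕ) : Type _ := Trajectory S A H × ℝ

/-- The observations made in the first `t` rounds: the parameters that were selected, each with the
feedback that followed. -/
abbrev History (Θ S A : Type*) (H t : ℕ) : Type _ := Fin t → Θ × Feedback S A H

theorem measurable_cons {X : Type*} [MeasurableSpace X] (n : ℕ) :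
    Measurable (fun x : X × (Fin n → X) => (Fin.cons x.1 x.2 : Fin (n + 1) → X)) := by
  refine measurable_pi_lambda _ fun i => ?_
  refine Fin.cases ?_ (fun j => ?_) i
  · simpa using measurable_fst
  · simpa [Function.comp_def] using (measurable_pi_apply j).comp measurable_snd

theorem measurable_snoc {X : Type*} [MeasurableSpace X] (n : ℕ) :
    Measurable (fun x : (Fin n → X) × X => (Fin.snoc x.1 x.2 : Fin (n + 1) → X)) := by
  refine measurable_pi_lambda _ fun i => ?_
  refine Fin.lastCases ?_ (fun j => ?_) i
  · simpa using measurable_snd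
  · simpa [Function.comp_def] using (measurable_pi_apply j).comp measurable_fst

section

variable {S A : Type*} [MeasurableSpace S] [MeasurableSpace A]

namespace MDP

/-- The discounted return `∑ h < H, γ ^ h * R (s_h, a_h)` of a trajectory. -/
noncomputable def ret (M : MDP S A) {H : ℕ} (τ : Trajectory S A H) : ℝ :=
  ∑ h : Fin H, M.discount ^ (h : ℕ) * M.reward (τ h)

theorem measurable_ret (M : MDP S A) (H : ℕ) :
    Measurable (fun τ : Trajectory S A H => M.ret τ) := by
  unfold ret
  exact Finset.measurable_sum _ fun h _ =>
    (M.measurable_reward.comp (measurable_pi_apply h)).const_mul _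

/-- Law of the trajectory of length `H` generated by the policy `π` from a given first state `s`:
draw `a ∼ π(· | s)` and `s' ∼ P(· | s, a)`, and put `(s, a)` in front of a trajectory of length
`H - 1` that starts from `s'`. -/
noncomputable def trajFrom (M : MDP S A) (π : Kernel S A) : (H : ℕ) → Kernel S (Trajectory S A H)
  | 0 => Kernel.const S (Measure.dirac Fin.elim0)
  | H + 1 =>
      ((Kernel.id ×ₖ π) ⊗ₖ Kernel.prodMkLeft S (M.trajFrom π H ∘ₖ M.trans)).map
        (fun x => (Fin.cons x.1 x.2 : Trajectory S A (H + 1)))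

instance (M : MDP S A) (π : Kernel S A) [IsMarkovKernel π] (H : ℕ) :
    IsMarkovKernel (M.trajFrom π H) := by
  induction H with
  | zero => unfold trajFrom; infer_instance
  | succ H ih => unfold trajFrom; exact Kernel.IsMarkovKernel.map _ (measurable_cons H)

/-- Trajectory distribution `p_π`: the initial state is drawn from `μ`. -/
noncomputable def trajLaw (M : MDP S A) (π : Kernel S A) (H : ℕ) : Measure (Trajectory S A H) :=
  M.init.bind (M.trajFrom π H)

instance (M : MDP S A) (π : Kernel S A) [IsMarkovKernel π] (H : ℕ) :
    IsProbabilityMeasure (M.trajLaw π H) := by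
  unfold trajLaw; infer_instance

/-- Expected return `J` of a policy. -/
noncomputable def J (M : MDP S A) (π : Kernel S A) (H : ℕ) : ℝ :=
  ∫ τ, M.ret τ ∂(M.trajLaw π H)

/-- Law of the mediator feedback `(τ, R(τ))`, `τ ∼ p_π`. -/
noncomputable def feedbackLaw (M : MDP S A) (π : Kernel S A) (H : ℕ) : Measure (Feedback S A H) :=
  (M.trajLaw π H).map (fun τ => (τ, M.ret τ))

instance (M : MDP S A) (π : Kernel S A) [IsMarkovKernel π] (H : ℕ) :
    IsProbabilityMeasure (M.feedbackLaw π H) := by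
  unfold feedbackLaw
  exact Measure.isProbabilityMeasure_map (measurable_id.prodMk (M.measurable_ret H)).aemeasurable

end MDP

/-- A (possibly randomized) algorithm for online policy optimization: after `t` rounds it draws the
next parameter from a distribution that depends measurably on the history of these rounds. -/
structure Algorithm (Θ S A : Type*) [MeasurableSpace Θ] [MeasurableSpace S] [MeasurableSpace A]
    (H : ℕ) where
  /-- law of the parameter of the round that follows a history of `t` rounds -/
  select : (t : ℕ) → Kernel (History Θ S A H t) Θ
  select_markov : ∀ t, IsMarkovKernel (select t)

attribute [instance] Algorithm.select_markov

variable {Θ : Type*} [MeasurableSpace Θ] [Countable Θ] [MeasurableSingletonClass Θ] {H : ℕ}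

/-- Law of the history of the first `t` rounds when the algorithm runs on the MDP `M` with the
policies `π θ`, `θ ∈ Θ`. -/
noncomputable def historyLaw (M : MDP S A) (π : Θ → Kernel S A) (alg : Algorithm Θ S A H) :
    (t : ℕ) → Measure (History Θ S A H t)
  | 0 => Measure.dirac Fin.elim0
  | t + 1 =>
      ((historyLaw M π alg t) ⊗ₘ (alg.select t ⊗ₖ Kernel.prodMkLeft (History Θ S A H t)
        (Kernel.ofFunOfCountable fun θ => M.feedbackLaw (π θ) H))).map
        (fun x => (Fin.snoc x.1 x.2 : History Θ S A H (t + 1)))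

instance (M : MDP S A) (π : Θ → Kernel S A) [∀ θ, IsMarkovKernel (π θ)]
    (alg : Algorithm Θ S A H) (t : ℕ) : IsProbabilityMeasure (historyLaw M π alg t) := by
  induction t with
  | zero => unfold historyLaw; infer_instance
  | succ t ih =>
    have : IsMarkovKernel
        (Kernel.ofFunOfCountable fun θ => M.feedbackLaw (π θ) H : Kernel Θ (Feedback S A H)) :=
      ⟨fun θ => inferInstanceAs (IsProbabilityMeasure (M.feedbackLaw (π θ) H))⟩
    unfold historyLaw
    exact Measure.isProbabilityMeasure_map (measurable_snoc t).aemeasurable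

/-- Optimality gap `Δ(θ) = sup_θ' J(θ') - J(θ)`. -/
noncomputable def gap (M : MDP S A) (π : Θ → Kernel S A) (H : ℕ) (θ : Θ) : ℝ :=
  (⨆ θ', M.J (π θ') H) - M.J (π θ) H

/-- Expected cumulative regret `E R(n)`, `R(n) = ∑ t ≤ n, Δ(θ_t)`. -/
noncomputable def expectedRegret (M : MDP S A) (π : Θ → Kernel S A) (alg : Algorithm Θ S A H)
    (n : ℕ) : ℝ :=
  ∫ h, ∑ t : Fin n, gap M π H (h t).1 ∂(historyLaw M π alg n)

end

end PolicyOpt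

/-! A two-point argument. Each model is a two-step MDP in which the first action tilts the chance of
reaching the rewarding state. The models tilt by `d` and `-d`, the policies toss coins of bias `q`
and `-q`, and so `J = c (1 ± q d) / 2`: the gap is `c q d = Δ`, and passing to the other model swaps
the better policy.

The likelihood ratio of a trajectory between the two models does not involve the policy, because
action probabilities cancel. For the same reason the algorithm's own choices cancel in the ratio of
two history laws, which is the product of the trajectory ratios (`historyLaw_eq_withDensity`). Its
second moment after `t` rounds is at most `C ^ t` with `C = (1 + 3 d²) / (1 - d²)`
(`lintegral_likelihood_sq_le`).

While `C ^ t ≤ 2`, the probability of choosing a given policy differs between the models by at most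
`1 / 2` in the relevant direction (`integral_withDensity_sub_le_half`), so the two expected regrets
of the round add up to at least `Δ / 2`. This lasts for about `1 / (8 Δ²)` rounds, hence the regrets
sum to at least `1 / (16 Δ)` and the larger is at least half of that. Regret is monotone in `n`, so
the bound persists. -/

namespace PolicyOpt

open scoped NNReal

/-! ### Likelihood ratios of histories -/

section Likelihood

variable {S A Θ : Type*} {H : ℕ}

/-- The likelihood ratio of a history, for a likelihood ratio `ℓ` of trajectories. -/
def likelihood (ℓ : Trajectory S A H → ℝ≥0) {t : ℕ} (h : History Θ S A H t) : ℝ≥0 :=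
  ∏ i, ℓ (h i).2.1

theorem measurable_likelihood [MeasurableSpace S] [MeasurableSpace A] [MeasurableSpace Θ]
    {ℓ : Trajectory S A H → ℝ≥0} (hℓ : Measurable ℓ) (t : ℕ) :
    Measurable (likelihood ℓ : History Θ S A H t → ℝ≥0) := by
  unfold likelihood
  exact Finset.measurable_prod _ fun i _ => by fun_prop

theorem likelihood_snoc (ℓ : Trajectory S A H → ℝ≥0) {t : ℕ} (h : History Θ S A H t)
    (x : Θ × Feedback S A H) :
    likelihood ℓ (Fin.snoc h x : History Θ S A H (t + 1)) = likelihood ℓ h * ℓ x.2.1 := by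
  simp [likelihood, Fin.prod_univ_castSucc]

end Likelihood

/-! ### One-round recursions for the history law and the regret -/

section Bandit

variable {S A : Type*} [MeasurableSpace S] [MeasurableSpace A]
variable {Θ : Type*} [MeasurableSpace Θ] [Countable Θ] [MeasurableSingletonClass Θ] {H : ℕ}

/-- The mediator feedback as a kernel from parameters to feedback. -/
noncomputable def feedbackKernel (M : MDP S A) (π : Θ → Kernel S A) (H : ℕ) :
    Kernel Θ (Feedback S A H) :=
  Kernel.ofFunOfCountable fun θ => M.feedbackLaw (π θ) H

instance (M : MDP S A) (π : Θ → Kernel S A) [∀ θ, IsMarkovKernel (π θ)] :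
    IsMarkovKernel (feedbackKernel M π H) :=
  ⟨fun θ => inferInstanceAs (IsProbabilityMeasure (M.feedbackLaw (π θ) H))⟩

/-- The joint law of the parameter and the feedback of the next round, given the history. -/
noncomputable def roundKernel (M : MDP S A) (π : Θ → Kernel S A) (alg : Algorithm Θ S A H) (t : ℕ) :
    Kernel (History Θ S A H t) (Θ × Feedback S A H) :=
  alg.select t ⊗ₖ Kernel.prodMkLeft (History Θ S A H t) (feedbackKernel M π H)

instance (M : MDP S A) (π : Θ → Kernel S A) [∀ θ, IsMarkovKernel (π θ)]
    (alg : Algorithm Θ S A H) (t : ℕ) : IsMarkovKernel (roundKernel M π alg t) := by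
  unfold roundKernel; infer_instance

theorem historyLaw_succ (M : MDP S A) (π : Θ → Kernel S A) (alg : Algorithm Θ S A H) (t : ℕ) :
    historyLaw M π alg (t + 1) = ((historyLaw M π alg t) ⊗ₘ roundKernel M π alg t).map
      (fun x => (Fin.snoc x.1 x.2 : History Θ S A H (t + 1))) := rfl

theorem lintegral_historyLaw_succ (M : MDP S A) (π : Θ → Kernel S A) [∀ θ, IsMarkovKernel (π θ)]
    (alg : Algorithm Θ S A H) (t : ℕ) {f : History Θ S A H (t + 1) → ℝ≥0∞} (hf : Measurable f) :
    ∫⁻ h, f h ∂(historyLaw M π alg (t + 1)) =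
      ∫⁻ h, ∫⁻ x, f (Fin.snoc h x) ∂(roundKernel M π alg t h) ∂(historyLaw M π alg t) := by
  rw [historyLaw_succ, lintegral_map hf (measurable_snoc t),
    Measure.lintegral_compProd (f := fun x => f (Fin.snoc x.1 x.2)) (hf.comp (measurable_snoc t))]

theorem map_init_historyLaw_succ (M : MDP S A) (π : Θ → Kernel S A) [∀ θ, IsMarkovKernel (π θ)]
    (alg : Algorithm Θ S A H) (t : ℕ) :
    (historyLaw M π alg (t + 1)).map (fun h (i : Fin t) => h i.castSucc) =
      historyLaw M π alg t := by
  have hm : Measurable (fun (h : History Θ S A H (t + 1)) (i : Fin t) => h i.castSucc) := by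
    fun_prop
  rw [historyLaw_succ, Measure.map_map hm (measurable_snoc t)]
  have : ((fun (h : History Θ S A H (t + 1)) (i : Fin t) => h i.castSucc) ∘
      fun x : History Θ S A H t × (Θ × Feedback S A H) =>
        (Fin.snoc x.1 x.2 : History Θ S A H (t + 1))) = Prod.fst := by
    ext1 x; funext i; simp
  rw [this]
  exact Measure.fst_compProd _ _

theorem fst_roundKernel (M : MDP S A) (π : Θ → Kernel S A) [∀ θ, IsMarkovKernel (π θ)]
    (alg : Algorithm Θ S A H) (t : ℕ) (h : History Θ S A H t) :
    (roundKernel M π alg t h).map Prod.fst = alg.select t h := by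
  rw [← Kernel.map_apply _ measurable_fst, ← Kernel.fst_eq, roundKernel, Kernel.fst_compProd]

/-- The parameter of the last round is drawn from the distribution selected by the algorithm. -/
theorem integral_historyLaw_last (M : MDP S A) (π : Θ → Kernel S A) [∀ θ, IsMarkovKernel (π θ)]
    (alg : Algorithm Θ S A H) (t : ℕ) {g : Θ → ℝ} (C : ℝ) (hC : ∀ θ, |g θ| ≤ C) :
    ∫ h, g (h (Fin.last t)).1 ∂(historyLaw M π alg (t + 1)) =
      ∫ h, ∫ θ, g θ ∂(alg.select t h) ∂(historyLaw M π alg t) := by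
  have hg : Measurable g := measurable_of_countable g
  have hm : Measurable (fun h : History Θ S A H (t + 1) => g (h (Fin.last t)).1) := by fun_prop
  rw [historyLaw_succ, integral_map (measurable_snoc t).aemeasurable hm.aestronglyMeasurable]
  simp only [Fin.snoc_last]
  rw [Measure.integral_compProd]
  · refine integral_congr_ae (.of_forall fun h => ?_)
    simp only
    rw [← fst_roundKernel M π alg t h, integral_map measurable_fst.aemeasurable
      hg.aestronglyMeasurable]
  · have hm' : Measurable fun x : History Θ S A H t × (Θ × Feedback S A H) => g x.2.1 := by fun_prop
    exact .of_bound hm'.aestronglyMeasurable C (.of_forall fun x => hC _)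

theorem expectedRegret_zero (M : MDP S A) (π : Θ → Kernel S A) (alg : Algorithm Θ S A H) :
    expectedRegret M π alg 0 = 0 := by
  simp [expectedRegret]

theorem expectedRegret_succ (M : MDP S A) (π : Θ → Kernel S A) [∀ θ, IsMarkovKernel (π θ)]
    (alg : Algorithm Θ S A H) (t : ℕ) {C : ℝ} (hC : ∀ θ, |gap M π H θ| ≤ C) :
    expectedRegret M π alg (t + 1) = expectedRegret M π alg t +
      ∫ h, ∫ θ, gap M π H θ ∂(alg.select t h) ∂(historyLaw M π alg t) := by
  have hg : Measurable (gap M π H) := measurable_of_countable _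
  have hi : ∀ i : Fin (t + 1), Integrable (fun h => gap M π H (h i).1)
      (historyLaw M π alg (t + 1)) := fun i => by
    have hm : Measurable fun h : History Θ S A H (t + 1) => gap M π H (h i).1 := by fun_prop
    exact .of_bound hm.aestronglyMeasurable C (.of_forall fun x => hC _)
  unfold expectedRegret
  simp_rw [Fin.sum_univ_castSucc]
  rw [integral_add (integrable_finsetSum _ fun i _ => hi _) (hi _),
    integral_historyLaw_last M π alg t C hC]
  congr 1
  have hm : Measurable (fun (h : History Θ S A H (t + 1)) (i : Fin t) => h i.castSucc) := by
    fun_prop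
  rw [← map_init_historyLaw_succ M π alg t, integral_map hm.aemeasurable]
  exact (Finset.measurable_sum _ fun i _ => by fun_prop).aestronglyMeasurable

theorem lintegral_roundKernel (M : MDP S A) (π : Θ → Kernel S A) [∀ θ, IsMarkovKernel (π θ)]
    (alg : Algorithm Θ S A H) (t : ℕ) (h : History Θ S A H t)
    {f : Θ × Feedback S A H → ℝ≥0∞} (hf : Measurable f) :
    ∫⁻ x, f x ∂(roundKernel M π alg t h) =
      ∫⁻ θ, ∫⁻ τ, f (θ, (τ, M.ret τ)) ∂(M.trajLaw (π θ) H) ∂(alg.select t h) := by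
  rw [roundKernel, Kernel.lintegral_compProd _ _ _ hf]
  refine lintegral_congr fun θ => ?_
  change ∫⁻ y, f (θ, y) ∂((M.trajLaw (π θ) H).map fun τ => (τ, M.ret τ)) = _
  exact lintegral_map (by fun_prop) (measurable_id.prodMk (M.measurable_ret H))

/-! ### Change of measure between two models -/

section ChangeOfMeasure

variable {M₀ M₁ : MDP S A} {π : Θ → Kernel S A} [∀ θ, IsMarkovKernel (π θ)]
  {ℓ : Trajectory S A H → ℝ≥0}

theorem lintegral_roundKernel_change (hℓ : Measurable ℓ)
    (hret : ∀ τ : Trajectory S A H, M₁.ret τ = M₀.ret τ)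
    (hlaw : ∀ θ, M₁.trajLaw (π θ) H = (M₀.trajLaw (π θ) H).withDensity fun τ => (ℓ τ : ℝ≥0∞))
    (alg : Algorithm Θ S A H) (t : ℕ) (h : History Θ S A H t)
    {f : Θ × Feedback S A H → ℝ≥0∞} (hf : Measurable f) :
    ∫⁻ x, f x ∂(roundKernel M₁ π alg t h) =
      ∫⁻ x, ℓ x.2.1 * f x ∂(roundKernel M₀ π alg t h) := by
  rw [lintegral_roundKernel M₁ π alg t h hf,
    lintegral_roundKernel M₀ π alg t h (by fun_prop)]
  refine lintegral_congr fun θ => ?_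
  rw [hlaw, lintegral_withDensity_eq_lintegral_mul _ (by fun_prop)]
  · simp only [Pi.mul_apply, hret]
  · exact hf.comp (measurable_const.prodMk (measurable_id.prodMk (M₁.measurable_ret H)))

/-- Each round contributes one factor `ℓ`, the same for every parameter. The selection kernels are
common to both models and contribute nothing, which is why arbitrary adaptive randomized algorithms
are covered. -/
theorem lintegral_historyLaw_change (hℓ : Measurable ℓ)
    (hret : ∀ τ : Trajectory S A H, M₁.ret τ = M₀.ret τ)
    (hlaw : ∀ θ, M₁.trajLaw (π θ) H = (M₀.trajLaw (π θ) H).withDensity fun τ => (ℓ τ : ℝ≥0∞))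
    (alg : Algorithm Θ S A H) (t : ℕ) {f : History Θ S A H t → ℝ≥0∞} (hf : Measurable f) :
    ∫⁻ h, f h ∂(historyLaw M₁ π alg t) =
      ∫⁻ h, likelihood ℓ h * f h ∂(historyLaw M₀ π alg t) := by
  induction t with
  | zero => simp [historyLaw, likelihood]
  | succ t ih =>
    have hL := fun t => measurable_likelihood (Θ := Θ) hℓ t
    have hs : Measurable fun p : History Θ S A H t × (Θ × Feedback S A H) =>
        f (Fin.snoc p.1 p.2) := hf.comp (measurable_snoc t)
    have hs' : ∀ h : History Θ S A H t, Measurable fun x : Θ × Feedback S A H =>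
        f (Fin.snoc h x : History Θ S A H (t + 1)) := fun h =>
      hs.comp (measurable_const.prodMk measurable_id)
    rw [lintegral_historyLaw_succ _ _ _ _ hf,
      lintegral_historyLaw_succ _ _ _ _ (f := fun h => likelihood ℓ h * f h)
        ((hL _).coe_nnreal_ennreal.mul hf)]
    simp_rw [lintegral_roundKernel_change hℓ hret hlaw alg t _ (hs' _), likelihood_snoc]
    have hℓ' : Measurable fun x : Θ × Feedback S A H => (ℓ x.2.1 : ℝ≥0∞) := by fun_prop
    rw [ih (Measurable.lintegral_kernel_prod_right' (f := fun p : History Θ S A H t ×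
      (Θ × Feedback S A H) => (ℓ p.2.2.1 : ℝ≥0∞) * f (Fin.snoc p.1 p.2))
      ((hℓ'.comp measurable_snd).mul hs))]
    refine lintegral_congr fun h => ?_
    refine (lintegral_const_mul _ (hℓ'.mul (hs' h))).symm.trans ?_
    simp [mul_assoc]

theorem historyLaw_eq_withDensity (hℓ : Measurable ℓ)
    (hret : ∀ τ : Trajectory S A H, M₁.ret τ = M₀.ret τ)
    (hlaw : ∀ θ, M₁.trajLaw (π θ) H = (M₀.trajLaw (π θ) H).withDensity fun τ => (ℓ τ : ℝ≥0∞))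
    (alg : Algorithm Θ S A H) (t : ℕ) :
    historyLaw M₁ π alg t =
      (historyLaw M₀ π alg t).withDensity fun h => (likelihood ℓ h : ℝ≥0∞) := by
  have hL := measurable_likelihood (Θ := Θ) hℓ t
  refine Measure.ext_of_lintegral _ fun f hf => ?_
  rw [lintegral_historyLaw_change hℓ hret hlaw alg t hf,
    lintegral_withDensity_eq_lintegral_mul _ (by fun_prop) hf]
  rfl

/-- Given the past, the squared ratio grows in mean by a factor of at most `C`, whichever parameter
is drawn. -/
theorem lintegral_likelihood_sq_le (hℓ : Measurable ℓ) {C : ℝ≥0∞}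
    (hC : ∀ θ, ∫⁻ τ, (ℓ τ : ℝ≥0∞) ^ 2 ∂(M₀.trajLaw (π θ) H) ≤ C)
    (alg : Algorithm Θ S A H) (t : ℕ) :
    ∫⁻ h, (likelihood ℓ h : ℝ≥0∞) ^ 2 ∂(historyLaw M₀ π alg t) ≤ C ^ t := by
  induction t with
  | zero => simp [historyLaw, likelihood]
  | succ t ih =>
    have hL := fun t => measurable_likelihood (Θ := Θ) hℓ t
    rw [lintegral_historyLaw_succ _ _ _ _ ((hL _).coe_nnreal_ennreal.pow_const 2)]
    have key : ∀ h : History Θ S A H t, ∫⁻ x, (likelihood ℓ (Fin.snoc h x :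
        History Θ S A H (t + 1)) : ℝ≥0∞) ^ 2 ∂(roundKernel M₀ π alg t h) ≤
        C * (likelihood ℓ h : ℝ≥0∞) ^ 2 := fun h => by
      simp_rw [likelihood_snoc, ENNReal.coe_mul, mul_pow]
      rw [lintegral_const_mul _ (by fun_prop), mul_comm]
      gcongr
      rw [lintegral_roundKernel _ _ _ _ _ (by fun_prop)]
      calc _ ≤ ∫⁻ _, C ∂(alg.select t h) := lintegral_mono fun θ => hC θ
        _ = C := by simp
    calc _ ≤ ∫⁻ h, C * (likelihood ℓ h : ℝ≥0∞) ^ 2 ∂(historyLaw M₀ π alg t) := lintegral_mono key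
      _ = C * ∫⁻ h, (likelihood ℓ h : ℝ≥0∞) ^ 2 ∂(historyLaw M₀ π alg t) :=
        lintegral_const_mul _ ((hL t).coe_nnreal_ennreal.pow_const 2)
      _ ≤ C ^ (t + 1) := by rw [pow_succ']; gcongr

end ChangeOfMeasure

end Bandit

/-- A change of measure whose density has second moment at most `2` shifts the mean of a
`[0, 1]`-valued function by at most `1 / 2`. -/
theorem integral_withDensity_sub_le_half {α : Type*} [MeasurableSpace α] {μ : Measure α}
    [IsProbabilityMeasure μ] {L : α → ℝ≥0} (hL : Measurable L)
    [IsProbabilityMeasure (μ.withDensity fun x => (L x : ℝ≥0∞))]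
    (hL2 : ∫⁻ x, (L x : ℝ≥0∞) ^ 2 ∂μ ≤ 2) {g : α → ℝ} (hg : Measurable g)
    (hg01 : ∀ x, g x ∈ Set.Icc (0 : ℝ) 1) :
    ∫ x, g x ∂(μ.withDensity fun x => (L x : ℝ≥0∞)) - ∫ x, g x ∂μ ≤ 1 / 2 := by
  have hLr : Measurable fun x => (L x : ℝ) := by fun_prop
  have e : ∀ x, ENNReal.ofReal ((L x : ℝ) ^ 2) = (L x : ℝ≥0∞) ^ 2 := fun x => by
    rw [ENNReal.ofReal_pow (by positivity), ENNReal.ofReal_coe_nnreal]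
  have hi2 : Integrable (fun x => (L x : ℝ) ^ 2) μ := by
    refine ⟨by fun_prop, ?_⟩
    rw [hasFiniteIntegral_iff_ofReal (.of_forall fun x => by positivity)]
    simp_rw [e]
    exact hL2.trans_lt (by simp)
  have hi1 : Integrable (fun x => (L x : ℝ)) μ :=
    ((memLp_two_iff_integrable_sq hLr.aestronglyMeasurable).2 hi2).integrable one_le_two
  have h2 : ∫ x, (L x : ℝ) ^ 2 ∂μ ≤ 2 := by
    rw [integral_eq_lintegral_of_nonneg_ae (.of_forall fun x => by positivity) (by fun_prop)]
    simp_rw [e]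
    exact ENNReal.toReal_le_of_le_ofReal (by norm_num) (by simpa using hL2)
  have h1 : ∫ x, (L x : ℝ) ∂μ = 1 := by
    have := integral_withDensity_eq_integral_smul (μ := μ) hL (fun _ => (1 : ℝ))
    simpa [NNReal.smul_def] using this.symm
  have hgi : Integrable g μ := .of_bound hg.aestronglyMeasurable 1 (.of_forall fun x => by
    rw [Real.norm_eq_abs, abs_le]; constructor <;> linarith [(hg01 x).1, (hg01 x).2])
  have hgL : Integrable (fun x => (L x : ℝ) * g x) μ :=
    hi1.mul_bdd (c := 1) hg.aestronglyMeasurable (.of_forall fun x => by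
      rw [Real.norm_eq_abs, abs_le]; constructor <;> linarith [(hg01 x).1, (hg01 x).2])
  rw [integral_withDensity_eq_integral_smul hL]
  simp only [NNReal.smul_def, smul_eq_mul]
  rw [← integral_sub hgL hgi]
  have hb : Integrable (fun x => (L x : ℝ) ^ 2 / 4) μ := hi2.div_const 4
  -- Pointwise, `(L - 2)² ≥ 0` gives `L - 1 ≤ L² / 4`, and multiplying the left side by `g ∈ [0, 1]`
  -- preserves this because the right side is nonnegative.
  calc ∫ x, ((L x : ℝ) * g x - g x) ∂μ ≤ ∫ x, ((L x : ℝ) ^ 2 / 4) ∂μ := by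
        refine integral_mono (hgL.sub hgi) hb fun x => ?_
        obtain ⟨h0, h1⟩ := hg01 x
        simp only
        nlinarith [sq_nonneg ((L x : ℝ) - 2)]
    _ ≤ 1 / 2 := by rw [integral_div]; linarith

/-! ### Lower bound for two policies whose roles are exchanged -/

section TwoPolicies

variable {S A : Type*} [MeasurableSpace S] [MeasurableSpace A] {H : ℕ}
  {M₀ M₁ : MDP S A} {π : Fin 2 → Kernel S A} [∀ θ, IsMarkovKernel (π θ)]

theorem gap_two (M : MDP S A) (π : Fin 2 → Kernel S A) (H : ℕ) (θ : Fin 2) :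
    gap M π H θ = max (M.J (π 0) H) (M.J (π 1) H) - M.J (π θ) H := by
  rw [gap]
  congr 1
  refine le_antisymm (ciSup_le fun θ' => ?_) (max_le ?_ ?_)
  · fin_cases θ'
    · exact le_max_left _ _
    · exact le_max_right _ _
  · exact le_ciSup (f := fun θ' => M.J (π θ') H) (Set.finite_range _).bddAbove 0
  · exact le_ciSup (f := fun θ' => M.J (π θ') H) (Set.finite_range _).bddAbove 1

theorem integral_fin_two {μ : Measure (Fin 2)} [IsProbabilityMeasure μ] (g : Fin 2 → ℝ) :
    ∫ θ, g θ ∂μ = g 0 * (1 - μ.real {1}) + g 1 * μ.real {1} := by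
  have h := probReal_compl_eq_one_sub (μ := μ) (measurableSet_singleton (1 : Fin 2))
  have e : ({1}ᶜ : Set (Fin 2)) = {0} := by ext x; fin_cases x <;> simp
  rw [e] at h
  rw [integral_fintype (.of_finite), Fin.sum_univ_two, h, smul_eq_mul, smul_eq_mul]
  ring

theorem expectedRegret_mono (M : MDP S A) (π : Fin 2 → Kernel S A) [∀ θ, IsMarkovKernel (π θ)]
    (alg : Algorithm (Fin 2) S A H) : Monotone (expectedRegret M π alg) := by
  have h0 : ∀ θ, 0 ≤ gap M π H θ := fun θ => by
    rw [gap_two]; fin_cases θ <;> simp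
  have hC : ∀ θ, |gap M π H θ| ≤ gap M π H 0 + gap M π H 1 := fun θ => by
    rw [abs_of_nonneg (h0 θ)]
    fin_cases θ
    · exact le_add_of_nonneg_right (h0 1)
    · exact le_add_of_nonneg_left (h0 0)
  refine monotone_nat_of_le_succ fun t => ?_
  rw [expectedRegret_succ M π alg t hC]
  exact le_add_of_nonneg_right (integral_nonneg fun h => integral_nonneg h0)

variable {ℓ : Trajectory S A H → ℝ≥0}

/-- With `g` the probability of selecting policy `1`, a round costs `Δ E₀[g]` in the first model and
`Δ (1 - E₁[g])` in the second. The sum is at least `Δ / 2` once `E₁[g] - E₀[g] ≤ 1 / 2`. Only `k <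
N` is needed in `hN`, since a choice depends on the strictly earlier rounds. -/
theorem le_expectedRegret_add (hℓ : Measurable ℓ)
    (hret : ∀ τ : Trajectory S A H, M₁.ret τ = M₀.ret τ)
    (hlaw : ∀ θ, M₁.trajLaw (π θ) H = (M₀.trajLaw (π θ) H).withDensity fun τ => (ℓ τ : ℝ≥0∞))
    {C : ℝ≥0∞} (hC : ∀ θ, ∫⁻ τ, (ℓ τ : ℝ≥0∞) ^ 2 ∂(M₀.trajLaw (π θ) H) ≤ C)
    {Δ : ℝ} (hΔ : 0 ≤ Δ) (h₀ : M₀.J (π 0) H - M₀.J (π 1) H = Δ)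
    (h₁ : M₁.J (π 1) H - M₁.J (π 0) H = Δ) (alg : Algorithm (Fin 2) S A H) {N : ℕ}
    (hN : ∀ k < N, C ^ k ≤ 2) :
    N * (Δ / 2) ≤ expectedRegret M₀ π alg N + expectedRegret M₁ π alg N := by
  have g00 : gap M₀ π H 0 = 0 := by rw [gap_two, max_eq_left (by linarith)]; ring
  have g01 : gap M₀ π H 1 = Δ := by rw [gap_two, max_eq_left (by linarith)]; exact h₀
  have g10 : gap M₁ π H 0 = Δ := by rw [gap_two, max_eq_right (by linarith)]; exact h₁
  have g11 : gap M₁ π H 1 = 0 := by rw [gap_two, max_eq_right (by linarith)]; ring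
  have b0 : ∀ θ, |gap M₀ π H θ| ≤ Δ := fun θ => by
    fin_cases θ <;> simp [g00, g01, hΔ, abs_of_nonneg]
  have b1 : ∀ θ, |gap M₁ π H θ| ≤ Δ := fun θ => by
    fin_cases θ <;> simp [g10, g11, hΔ, abs_of_nonneg]
  induction N with
  | zero => simp [expectedRegret_zero]
  | succ t ih =>
    have ih := ih fun k hk => hN k (hk.trans t.lt_succ_self)
    rw [expectedRegret_succ M₀ π alg t b0, expectedRegret_succ M₁ π alg t b1]
    simp_rw [integral_fin_two, g00, g01, g10, g11]
    simp only [zero_mul, zero_add, add_zero, integral_const_mul]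
    have hgm : Measurable fun h => (alg.select t h).real {1} :=
      (Kernel.measurable_coe _ (measurableSet_singleton 1)).ennreal_toReal
    have hg01 : ∀ h, (alg.select t h).real {1} ∈ Set.Icc (0 : ℝ) 1 := fun h =>
      ⟨measureReal_nonneg, measureReal_le_one⟩
    have hgi : Integrable (fun h => (alg.select t h).real {1}) (historyLaw M₁ π alg t) :=
      .of_bound hgm.aestronglyMeasurable 1 (.of_forall fun h => by
        rw [Real.norm_eq_abs, abs_of_nonneg (hg01 h).1]; exact (hg01 h).2)
    have key : ∫ h, (alg.select t h).real {1} ∂(historyLaw M₁ π alg t) -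
        ∫ h, (alg.select t h).real {1} ∂(historyLaw M₀ π alg t) ≤ 1 / 2 := by
      have e := historyLaw_eq_withDensity hℓ hret hlaw alg t
      have : IsProbabilityMeasure ((historyLaw M₀ π alg t).withDensity
          fun h => (likelihood ℓ h : ℝ≥0∞)) := e ▸ inferInstance
      rw [e]
      exact integral_withDensity_sub_le_half (measurable_likelihood hℓ t)
        ((lintegral_likelihood_sq_le hℓ hC alg t).trans (hN t t.lt_succ_self)) hgm hg01
    rw [integral_sub (integrable_const _) hgi]
    simp only [integral_const, probReal_univ, smul_eq_mul, mul_one]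
    push_cast
    nlinarith

theorem le_max_expectedRegret (hℓ : Measurable ℓ)
    (hret : ∀ τ : Trajectory S A H, M₁.ret τ = M₀.ret τ)
    (hlaw : ∀ θ, M₁.trajLaw (π θ) H = (M₀.trajLaw (π θ) H).withDensity fun τ => (ℓ τ : ℝ≥0∞))
    {C : ℝ≥0∞} (hC : ∀ θ, ∫⁻ τ, (ℓ τ : ℝ≥0∞) ^ 2 ∂(M₀.trajLaw (π θ) H) ≤ C)
    {Δ : ℝ} (hΔ : 0 < Δ) (h₀ : M₀.J (π 0) H - M₀.J (π 1) H = Δ)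
    (h₁ : M₁.J (π 1) H - M₁.J (π 0) H = Δ)
    (hN : ∀ k : ℕ, (k : ℝ) < 1 / (8 * Δ ^ 2) → C ^ k ≤ 2) :
    ∃ N : ℕ, ∀ n ≥ N, ∀ alg : Algorithm (Fin 2) S A H,
      1 / (32 * Δ) ≤ max (expectedRegret M₀ π alg n) (expectedRegret M₁ π alg n) := by
  -- Every `k` below this ceiling is below `1 / (8 Δ²)`, while `N Δ / 2` is at least `1 / (16 Δ)`.
  refine ⟨⌈1 / (8 * Δ ^ 2)⌉₊, fun n hn alg => ?_⟩
  have hsum := le_expectedRegret_add hℓ hret hlaw hC hΔ.le h₀ h₁ alg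
    (N := ⌈1 / (8 * Δ ^ 2)⌉₊) fun k hk => hN k (Nat.lt_ceil.1 hk)
  have hceil : 1 / (8 * Δ ^ 2) * (Δ / 2) ≤ ⌈1 / (8 * Δ ^ 2)⌉₊ * (Δ / 2) :=
    mul_le_mul_of_nonneg_right (Nat.le_ceil _) (by positivity)
  have e : 1 / (8 * Δ ^ 2) * (Δ / 2) = 2 * (1 / (32 * Δ)) := by field_simp; norm_num
  have m₀ := expectedRegret_mono M₀ π alg hn
  have m₁ := expectedRegret_mono M₁ π alg hn
  have := le_max_left (expectedRegret M₀ π alg n) (expectedRegret M₁ π alg n)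
  have := le_max_right (expectedRegret M₀ π alg n) (expectedRegret M₁ π alg n)
  linarith

end TwoPolicies

theorem MDP.lintegral_trajFrom_succ {S A : Type*} [MeasurableSpace S] [MeasurableSpace A]
    (M : MDP S A) (π : Kernel S A) [IsMarkovKernel π] (H : ℕ) (s : S)
    {f : Trajectory S A (H + 1) → ℝ≥0∞} (hf : Measurable f) :
    ∫⁻ τ, f τ ∂(M.trajFrom π (H + 1) s) = ∫⁻ a, ∫⁻ s', ∫⁻ τ, f (Fin.cons (s, a) τ)
      ∂(M.trajFrom π H s') ∂(M.trans (s, a)) ∂(π s) := by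
  have hc : Measurable fun x : (S × A) × Trajectory S A H =>
      f (Fin.cons x.1 x.2 : Trajectory S A (H + 1)) := hf.comp (measurable_cons H)
  have hc' : ∀ x : S × A, Measurable fun τ : Trajectory S A H =>
      f (Fin.cons x τ : Trajectory S A (H + 1)) := fun x =>
    hc.comp (measurable_const.prodMk measurable_id)
  rw [MDP.trajFrom, Kernel.lintegral_map _ (measurable_cons H) _ hf,
    Kernel.lintegral_compProd _ _ _ hc, Kernel.lintegral_id_prod]
  · refine lintegral_congr fun a => ?_
    simp only [Kernel.prodMkLeft_apply]
    rw [Kernel.lintegral_comp _ _ _ (hc' _)]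
  · exact Measurable.lintegral_kernel_prod_right'
      (κ := M.trajFrom π H ∘ₖ M.trans) hc

/-! ### The hard instance: a two-state MDP with horizon two -/

section TwoStep

/-- Probability that a coin with bias `u ∈ [-1, 1]` shows the side `b`. -/
noncomputable def coinWeight (u : ℝ) (b : Bool) : ℝ := (1 + bif b then u else -u) / 2

/-- The law on `Bool` with `P(true) = (1 + u) / 2` and `P(false) = (1 - u) / 2`. -/
noncomputable def coin (u : ℝ) : Measure Bool :=
  ∑ b, ENNReal.ofReal (coinWeight u b) • Measure.dirac b

theorem lintegral_coin (u : ℝ) (f : Bool → ℝ≥0∞) :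
    ∫⁻ b, f b ∂(coin u) = ENNReal.ofReal (coinWeight u true) * f true +
      ENNReal.ofReal (coinWeight u false) * f false := by
  simp [coin]

theorem coinWeight_nonneg {u : ℝ} (hu : |u| ≤ 1) (b : Bool) : 0 ≤ coinWeight u b := by
  have := abs_le.1 hu
  cases b <;> simp [coinWeight] <;> linarith

theorem coinWeight_pos {u : ℝ} (hu : |u| < 1) (b : Bool) : 0 < coinWeight u b := by
  have := abs_lt.1 hu
  cases b <;> simp [coinWeight] <;> linarith

theorem isProbabilityMeasure_coin {u : ℝ} (hu : |u| ≤ 1) : IsProbabilityMeasure (coin u) := by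
  refine ⟨?_⟩
  rw [← lintegral_one, lintegral_coin, mul_one, mul_one,
    ← ENNReal.ofReal_add (coinWeight_nonneg hu _) (coinWeight_nonneg hu _)]
  simp [coinWeight]
  ring

theorem abs_cond_neg_le {e : ℝ} (he : |e| ≤ 1) (a : Bool) : |bif a then e else -e| ≤ 1 := by
  cases a <;> simpa using he

/-- The two-state MDP that starts in the worthless state `false` and moves to the state `true`, of
reward `c`, with probability `(1 + e) / 2` under the action `true` and `(1 - e) / 2` under the
action `false`. -/
noncomputable def biasMDP (c e : ℝ) (he : |e| ≤ 1) : MDP Bool Bool where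
  init := Measure.dirac false
  trans := Kernel.ofFunOfCountable fun x => coin (bif x.2 then e else -e)
  reward x := bif x.1 then c else 0
  discount := 1
  init_prob := inferInstance
  trans_markov := ⟨fun x => isProbabilityMeasure_coin (abs_cond_neg_le he x.2)⟩
  measurable_reward := .of_discrete
  discount_mem := by simp

/-- The policy that tosses a coin of bias `u` in every state. -/
noncomputable def coinPolicy (u : ℝ) : Kernel Bool Bool := Kernel.const Bool (coin u)

theorem isMarkovKernel_coinPolicy {u : ℝ} (hu : |u| ≤ 1) : IsMarkovKernel (coinPolicy u) := by
  have := isProbabilityMeasure_coin hu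
  unfold coinPolicy; infer_instance

/-- The trajectory of length two with actions `a`, `b` and second state `s`. -/
def twoStep (a s b : Bool) : Trajectory Bool Bool 2 := ![(false, a), (s, b)]

variable {c e u : ℝ}

theorem ret_biasMDP (he : |e| ≤ 1) (τ : Trajectory Bool Bool 2) :
    (biasMDP c e he).ret τ = (bif (τ 0).1 then c else 0) + bif (τ 1).1 then c else 0 := by
  simp [MDP.ret, biasMDP, Fin.sum_univ_two]

theorem lintegral_trajLaw_biasMDP (he : |e| ≤ 1) (hu : |u| ≤ 1)
    (f : Trajectory Bool Bool 2 → ℝ≥0∞) :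
    ∫⁻ τ, f τ ∂((biasMDP c e he).trajLaw (coinPolicy u) 2) =
      ∫⁻ a, ∫⁻ s, ∫⁻ b, f (twoStep a s b) ∂(coin u) ∂(coin (bif a then e else -e)) ∂(coin u) := by
  have := isMarkovKernel_coinPolicy hu
  have := isProbabilityMeasure_coin hu
  rw [MDP.trajLaw, Measure.lintegral_bind (Kernel.aemeasurable _) (.of_discrete)]
  change ∫⁻ s, _ ∂(Measure.dirac false) = _
  rw [lintegral_dirac, MDP.lintegral_trajFrom_succ _ _ _ _ .of_discrete]
  refine lintegral_congr fun a => lintegral_congr fun s => ?_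
  rw [MDP.lintegral_trajFrom_succ _ _ _ _ .of_discrete]
  refine lintegral_congr fun b => ?_
  -- The recursion also draws a state after the last action; the empty remaining trajectory ignores
  -- it, so it integrates out to mass one.
  have := isProbabilityMeasure_coin (abs_cond_neg_le he b)
  change ∫⁻ s', ∫⁻ τ, _ ∂(Measure.dirac Fin.elim0) ∂(coin (bif b then e else -e)) = _
  simp only [lintegral_dirac, lintegral_const, measure_univ, mul_one]
  rfl

theorem ae_trajLaw_biasMDP (he : |e| ≤ 1) (hu : |u| ≤ 1) {p : Trajectory Bool Bool 2 → Prop}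
    (hp : ∀ a s b, p (twoStep a s b)) :
    ∀ᵐ τ ∂((biasMDP c e he).trajLaw (coinPolicy u) 2), p τ := by
  rw [ae_iff, ← lintegral_indicator_one .of_discrete, lintegral_trajLaw_biasMDP he hu]
  simp [hp]

theorem J_biasMDP (hc : 0 ≤ c) (he : |e| ≤ 1) (hu : |u| ≤ 1) :
    (biasMDP c e he).J (coinPolicy u) 2 = c * (1 + u * e) / 2 := by
  have := isProbabilityMeasure_coin hu
  have h0 : ∀ b : Bool, 0 ≤ bif b then c else 0 := fun b => by cases b <;> simp [hc]
  have hr : ∀ τ : Trajectory Bool Bool 2, 0 ≤ (biasMDP c e he).ret τ := fun τ => by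
    rw [ret_biasMDP]; exact add_nonneg (h0 _) (h0 _)
  have hw : 0 ≤ c * (1 + u * e) / 2 := by
    have : |u * e| ≤ 1 := by rw [abs_mul]; exact mul_le_one₀ hu (abs_nonneg _) he
    have := mul_nonneg hc (by linarith [(abs_le.1 this).1] : 0 ≤ 1 + u * e)
    linarith
  rw [MDP.J, integral_eq_lintegral_of_nonneg_ae (.of_forall hr)
    (Measurable.of_discrete).aestronglyMeasurable, lintegral_trajLaw_biasMDP he hu]
  simp only [ret_biasMDP, twoStep, lintegral_coin, Matrix.cons_val_zero, Matrix.cons_val_one,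
    cond_true, cond_false, add_zero, ENNReal.ofReal_zero, mul_zero, zero_add]
  have he' : |-e| ≤ 1 := by rwa [abs_neg]
  have n₁ := coinWeight_nonneg hu
  have n₂ := coinWeight_nonneg he
  have n₃ := coinWeight_nonneg he'
  rw [← ENNReal.toReal_ofReal hw]
  congr 1
  simp only [← ENNReal.ofReal_mul, ← ENNReal.ofReal_add, n₁, n₂, n₃, hc, mul_nonneg]
  have n₄ := add_nonneg (mul_nonneg (n₁ true) hc) (mul_nonneg (n₁ false) hc)
  rw [← ENNReal.ofReal_add (mul_nonneg (n₁ _) (mul_nonneg (n₂ _) n₄))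
    (mul_nonneg (n₁ _) (mul_nonneg (n₃ _) n₄))]
  congr 1
  simp [coinWeight]
  ring

/-- With strict biases all eight trajectories that start in `false` have positive mass under `u'`,
so a null set contains none of them. -/
theorem absolutelyContinuous_trajLaw_biasMDP (he : |e| < 1) {u' : ℝ} (hu : |u| < 1)
    (hu' : |u'| < 1) :
    (biasMDP c e he.le).trajLaw (coinPolicy u) 2 ≪
      (biasMDP c e he.le).trajLaw (coinPolicy u') 2 := by
  intro s hs
  rw [← lintegral_indicator_one .of_discrete] at hs ⊢
  rw [lintegral_trajLaw_biasMDP _ hu.le] at ⊢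
  rw [lintegral_trajLaw_biasMDP _ hu'.le] at hs
  have he' : |-e| < 1 := by rwa [abs_neg]
  have n₁ := fun b => (ENNReal.ofReal_pos.2 (coinWeight_pos hu' b)).ne'
  have n₂ := fun b => (ENNReal.ofReal_pos.2 (coinWeight_pos he b)).ne'
  have n₃ := fun b => (ENNReal.ofReal_pos.2 (coinWeight_pos he' b)).ne'
  simp only [lintegral_coin, cond_true, cond_false, add_eq_zero, mul_eq_zero, n₁, n₂, n₃,
    false_or] at hs
  obtain ⟨⟨⟨h1, h2⟩, h3, h4⟩, ⟨h5, h6⟩, h7, h8⟩ := hs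
  simp only [lintegral_coin, h1, h2, h3, h4, h5, h6, h7, h8, mul_zero, add_zero]

theorem klDiv_trajLaw_biasMDP_lt_top (he : |e| < 1) {u' : ℝ} (hu : |u| < 1) (hu' : |u'| < 1) :
    InformationTheory.klDiv ((biasMDP c e he.le).trajLaw (coinPolicy u) 2)
      ((biasMDP c e he.le).trajLaw (coinPolicy u') 2) < ∞ := by
  have := isMarkovKernel_coinPolicy hu.le
  exact (InformationTheory.klDiv_ne_top (absolutelyContinuous_trajLaw_biasMDP he hu hu')
    .of_finite).lt_top

/-- The likelihood ratio of a trajectory between the models of bias `-e` and `e`. -/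
noncomputable def biasRatio (e : ℝ) (τ : Trajectory Bool Bool 2) : ℝ≥0 :=
  Real.toNNReal (coinWeight (bif (τ 0).2 then -e else e) (τ 1).1 /
    coinWeight (bif (τ 0).2 then e else -e) (τ 1).1)

/-- Only the transition after the first action depends on the sign of `e`; the action weights are
common to both laws. Hence one ratio serves every `u`. -/
theorem trajLaw_biasMDP_neg (he : |e| < 1) (he' : |-e| ≤ 1) (hu : |u| ≤ 1) :
    (biasMDP c (-e) he').trajLaw (coinPolicy u) 2 =
      ((biasMDP c e he.le).trajLaw (coinPolicy u) 2).withDensity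
        fun τ => (biasRatio e τ : ℝ≥0∞) := by
  refine Measure.ext_of_lintegral _ fun f hf => ?_
  rw [lintegral_withDensity_eq_lintegral_mul _ .of_discrete hf, lintegral_trajLaw_biasMDP he' hu,
    lintegral_trajLaw_biasMDP he.le hu]
  refine lintegral_congr fun a => ?_
  have hpos : ∀ s, 0 < coinWeight (bif a then e else -e) s := fun s =>
    coinWeight_pos (by cases a <;> simpa using he) s
  have key : ∀ (s b : Bool), ENNReal.ofReal (coinWeight (bif a then -e else e) s) =
      ENNReal.ofReal (coinWeight (bif a then e else -e) s) * (biasRatio e (twoStep a s b)) := by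
    intro s b
    rw [biasRatio, ← ENNReal.ofReal, ← ENNReal.ofReal_mul (hpos s).le]
    simp only [twoStep, Matrix.cons_val_zero, Matrix.cons_val_one]
    rw [mul_div_cancel₀ _ (hpos s).ne']
  have hr : ∀ s b, biasRatio e (twoStep a s b) = biasRatio e (twoStep a s true) :=
    fun _ _ => rfl
  simp only [Pi.mul_apply, hr _ false, neg_neg, lintegral_coin, key _ true]
  ring

/-- For either first action the value is `((1 - e)² / (1 + e) + (1 + e)² / (1 - e)) / 2`, so
averaging over the actions changes nothing. -/
theorem lintegral_biasRatio_sq (he : |e| < 1) (hu : |u| ≤ 1) :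
    ∫⁻ τ, (biasRatio e τ : ℝ≥0∞) ^ 2 ∂((biasMDP c e he.le).trajLaw (coinPolicy u) 2) =
      ENNReal.ofReal ((1 + 3 * e ^ 2) / (1 - e ^ 2)) := by
  have := isProbabilityMeasure_coin hu
  have hb := abs_lt.1 he
  have h1 : 1 + e ≠ 0 := by linarith
  have h2 : 1 - e ≠ 0 := by linarith
  have h3 : 1 - e ^ 2 ≠ 0 := by
    rw [show 1 - e ^ 2 = (1 + e) * (1 - e) by ring]; exact mul_ne_zero h1 h2
  rw [lintegral_trajLaw_biasMDP he.le hu]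
  have key : ∀ a, ∫⁻ s, ∫⁻ b, (biasRatio e (twoStep a s b) : ℝ≥0∞) ^ 2 ∂(coin u)
      ∂(coin (bif a then e else -e)) = ENNReal.ofReal ((1 + 3 * e ^ 2) / (1 - e ^ 2)) := by
    intro a
    have hpos : ∀ s, 0 < coinWeight (bif a then e else -e) s := fun s =>
      coinWeight_pos (by cases a <;> simpa using he) s
    have hpos' : ∀ s, 0 < coinWeight (bif a then -e else e) s := fun s =>
      coinWeight_pos (by cases a <;> simpa using he) s
    have hr : ∀ s b, (biasRatio e (twoStep a s b) : ℝ≥0∞) ^ 2 =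
        ENNReal.ofReal ((coinWeight (bif a then -e else e) s /
          coinWeight (bif a then e else -e) s) ^ 2) := fun s b => by
      rw [ENNReal.ofReal_pow (div_pos (hpos' s) (hpos s)).le]; rfl
    simp only [hr, lintegral_const, measure_univ, mul_one]
    rw [lintegral_coin, ← ENNReal.ofReal_mul (hpos _).le, ← ENNReal.ofReal_mul (hpos _).le,
      ← ENNReal.ofReal_add (mul_nonneg (hpos _).le (sq_nonneg _))
        (mul_nonneg (hpos _).le (sq_nonneg _))]
    congr 1
    cases a <;> simp only [coinWeight, cond_true, cond_false, neg_neg, ← sub_eq_add_neg] <;>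
      field_simp <;> ring
  simp only [key, lintegral_const, measure_univ, mul_one]

end TwoStep

/-- The second moment of the likelihood ratio stays below `2` for `1 / (8 Δ²)` rounds. -/
theorem pow_secondMoment_le_two {Δ q : ℝ} (hΔ : 0 < Δ) (hq : 99 / 100 ≤ q) (k : ℕ)
    (hk : (k : ℝ) < 1 / (8 * Δ ^ 2)) :
    ((1 + 3 * (Δ / q) ^ 2) / (1 - (Δ / q) ^ 2)) ^ k ≤ 2 := by
  rcases k.eq_zero_or_pos with rfl | hpos
  · norm_num
  have hk1 : (1 : ℝ) ≤ k := by exact_mod_cast hpos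
  rw [lt_div_iff₀ (by positivity)] at hk
  -- A positive `k` in the range forces `Δ` to be small, which keeps `1 - x` away from zero.
  have hΔ2 : 8 * Δ ^ 2 < 1 := by nlinarith [sq_nonneg Δ]
  have hδ : (Δ / q) ^ 2 ≤ 103 / 100 * Δ ^ 2 := by
    rw [div_pow, div_le_iff₀ (by positivity)]
    nlinarith [sq_nonneg Δ, mul_le_mul hq hq (by norm_num) (by linarith)]
  set x := (Δ / q) ^ 2 with hx
  have hx0 : 0 ≤ x := sq_nonneg _
  have hx1 : 0 < 1 - x := by linarith
  -- The constant `11 / 2` leaves room for the losses in `q` and `1 - x`, yet is small enough that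
  -- the final exponent is below `11 / 16 < log 2`.
  have hy : 4 * x / (1 - x) ≤ 11 / 2 * Δ ^ 2 := by
    rw [div_le_iff₀ hx1]
    nlinarith [sq_nonneg Δ]
  have hexp : (1 + 3 * x) / (1 - x) ≤ Real.exp (11 / 2 * Δ ^ 2) := by
    have e : (1 + 3 * x) / (1 - x) = 4 * x / (1 - x) + 1 := by field_simp; ring
    rw [e]
    exact (Real.add_one_le_exp _).trans (Real.exp_le_exp.2 hy)
  calc ((1 + 3 * x) / (1 - x)) ^ k ≤ Real.exp (11 / 2 * Δ ^ 2) ^ k :=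
        pow_le_pow_left₀ (by positivity) hexp k
    _ = Real.exp (k * (11 / 2 * Δ ^ 2)) := (Real.exp_nat_mul _ _).symm
    _ ≤ Real.exp (Real.log 2) := by
        refine Real.exp_le_exp.2 ?_
        have := Real.log_two_gt_d9
        linarith
    _ = 2 := Real.exp_log (by norm_num)

/-- Scale `c` of the rewards, bias `q` of the policies and bias `d` of the transitions that produce
the gap `Δ`. -/
theorem exists_hard_parameters {Δ : ℝ} (hΔ : 0 < Δ) :
    ∃ c q d : ℝ, 0 ≤ c ∧ 0 < q ∧ q < 1 ∧ 0 < d ∧ d < 1 ∧ c * q * d = Δ ∧ (Δ < 1 → c = 1) ∧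
      ∀ k : ℕ, (k : ℝ) < 1 / (8 * Δ ^ 2) → ((1 + 3 * d ^ 2) / (1 - d ^ 2)) ^ k ≤ 2 := by
  rcases lt_or_ge Δ 1 with h | h
  · have hq : 0 < 1 - (1 - Δ) / 100 := by linarith
    -- The policy bias lies strictly between `Δ` and `1`, so that `d = Δ / q < 1`, and it is at
    -- least `99 / 100`, so that `d` is close to `Δ`.
    refine ⟨1, 1 - (1 - Δ) / 100, Δ / (1 - (1 - Δ) / 100), zero_le_one, hq, by linarith,
      div_pos hΔ hq, ?_, ?_, fun _ => rfl,
      fun k hk => pow_secondMoment_le_two hΔ (by linarith) k hk⟩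
    · rw [div_lt_one hq]; linarith
    · rw [one_mul, mul_div_cancel₀ _ hq.ne']
  -- For `Δ ≥ 1` the range of `k` contains only `0`: a single round already suffices, and any biases
  -- in `(0, 1)` do once the rewards are scaled.
  · refine ⟨4 * Δ, 1 / 2, 1 / 2, by positivity, by norm_num, by norm_num, by norm_num,
      by norm_num, by ring, fun h' => absurd h' h.not_gt, fun k hk => ?_⟩
    have hk1 : (k : ℝ) < 1 := by
      refine hk.trans_le ?_
      rw [div_le_one (by positivity)]
      nlinarith
    have hk0 : k = 0 := by
      have : k < 1 := by exact_mod_cast hk1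
      omega
    subst hk0
    norm_num

end PolicyOpt

/-! ### Assembly of the two hard models -/

theorem theorem1 (Δ : ℝ) (hΔ : 0 < Δ) :
    ∃ (S A : Type) (_ : MeasurableSpace S) (_ : MeasurableSpace A) (H : ℕ)
      (π : Fin 2 → Kernel S A) (M : Fin 2 → PolicyOpt.MDP S A),
      (∀ θ, IsMarkovKernel (π θ)) ∧
      -- the two MDPs differ in the transition model only
      (M 0).init = (M 1).init ∧ (M 0).reward = (M 1).reward ∧ (M 0).discount = (M 1).discount ∧
      -- the returns are integrable, and they lie in the unit interval if `Δ < 1`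
      (∀ i θ, Integrable (fun τ => (M i).ret τ) ((M i).trajLaw (π θ) H)) ∧
      (Δ < 1 → ∀ i θ, ∀ᵐ τ ∂((M i).trajLaw (π θ) H), (M i).ret τ ∈ Set.Icc (0 : ℝ) 1) ∧
      -- finite divergences in both directions
      (∀ i θ θ', InformationTheory.klDiv ((M i).trajLaw (π θ) H) ((M i).trajLaw (π θ') H) < ∞) ∧
      -- the gap is `Δ`: the first policy is optimal for the first MDP, the second for the second
      (M 0).J (π 0) H - (M 0).J (π 1) H = Δ ∧
      (M 1).J (π 1) H - (M 1).J (π 0) H = Δ ∧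
      -- the lower bound, uniformly over all algorithms
      ∃ N : ℕ, ∀ n ≥ N, ∀ alg : PolicyOpt.Algorithm (Fin 2) S A H,
        1 / (32 * Δ) ≤ max (PolicyOpt.expectedRegret (M 0) π alg n)
          (PolicyOpt.expectedRegret (M 1) π alg n) := by
  obtain ⟨c, q, d, hc, hq0, hq1, hd0, hd1, hgap, hc1, hN⟩ := PolicyOpt.exists_hard_parameters hΔ
  have hq : ∀ θ, |(![q, -q] : Fin 2 → ℝ) θ| < 1 := fun θ => by
    fin_cases θ <;> simpa [abs_of_pos hq0] using hq1
  have hd : ∀ i, |(![d, -d] : Fin 2 → ℝ) i| < 1 := fun i => by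
    fin_cases i <;> simpa [abs_of_pos hd0] using hd1
  have hmk : ∀ θ, IsMarkovKernel (PolicyOpt.coinPolicy ((![q, -q] : Fin 2 → ℝ) θ)) := fun θ =>
    PolicyOpt.isMarkovKernel_coinPolicy (hq θ).le
  have hJ := fun i θ => PolicyOpt.J_biasMDP hc (hd i).le (hq θ).le
  have h₀ := congrArg₂ (· - ·) (hJ 0 0) (hJ 0 1)
  have h₁ := congrArg₂ (· - ·) (hJ 1 1) (hJ 1 0)
  have hΔ₀ : c * (1 + q * d) / 2 - c * (1 + -q * d) / 2 = Δ := by rw [← hgap]; ring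
  have hΔ₁ : c * (1 + -q * -d) / 2 - c * (1 + q * -d) / 2 = Δ := by rw [← hgap]; ring
  refine ⟨Bool, Bool, inferInstance, inferInstance, 2,
    fun θ => PolicyOpt.coinPolicy ((![q, -q] : Fin 2 → ℝ) θ),
    fun i => PolicyOpt.biasMDP c ((![d, -d] : Fin 2 → ℝ) i) (hd i).le, hmk, rfl, rfl, rfl,
    fun i θ => .of_finite, fun hΔ1 i θ => ?_,
    fun i θ θ' => PolicyOpt.klDiv_trajLaw_biasMDP_lt_top (hd i) (hq θ) (hq θ'),
    h₀.trans hΔ₀, h₁.trans hΔ₁, ?_⟩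
  · refine PolicyOpt.ae_trajLaw_biasMDP (hd i).le (hq θ).le fun a s b => ?_
    rw [PolicyOpt.ret_biasMDP, hc1 hΔ1]
    cases s <;> simp [PolicyOpt.twoStep]
  · refine PolicyOpt.le_max_expectedRegret (ℓ := PolicyOpt.biasRatio d)
      (C := ENNReal.ofReal ((1 + 3 * d ^ 2) / (1 - d ^ 2))) .of_discrete
      (fun τ => (PolicyOpt.ret_biasMDP (hd 1).le τ).trans
        (PolicyOpt.ret_biasMDP (hd 0).le τ).symm)
      (fun θ => PolicyOpt.trajLaw_biasMDP_neg (hd 0) (hd 1).le (hq θ).le)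
      (fun θ => (PolicyOpt.lintegral_biasRatio_sq (hd 0) (hq θ).le).le) hΔ
      (h₀.trans hΔ₀) (h₁.trans hΔ₁) fun k hk => ?_
    have hd2 : 0 ≤ 1 - d ^ 2 := by nlinarith
    rw [← ENNReal.ofReal_pow (by positivity)]
    simpa using ENNReal.ofReal_le_ofReal (hN k hk)
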